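/- Let $n\geq 1$, let $G\subset \operatorname{O}(n)$ be a closed subgroup, and assume that $\operatorname{diam}(\mathbb{S}^{n-1}/G)<\pi/4$, where $\mathbb{S}^{n-1}\subset\mathbb{R}^n$ is the unit sphere and the distance between two $G$-orbits is the infimum of the angles $\angle(x,y)$ over points $x$ of the first and $y$ of the second orbit. Then every normal subgroup $N$ of $G$ acts on $\mathbb{R}^n$ either irreducibly or super-reducibly. Here super-reducible means that, as a real $N$-representation, $\mathbb{R}^n\cong W^k$ for some $k$ and some irreducible real $N$-representation $W$ with $\dim_F W=1$, where $F\in\{\mathbb{R},\mathbb{C},\mathbb{H}\}$ is the type of $W$, that is, the real algebra $F\cong\operatorname{End}_N(W)$ of $N$-equivariant endomorphisms of $W$, acting on $W$ through this isomorphism. -/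

import Mathlib

noncomputable section

namespace SphereQuotient

open Metric InnerProductGeometry

/-- The Euclidean space `ℝⁿ`. -/
abbrev E (n : ℕ) : Type := EuclideanSpace ℝ (Fin n)

/-- The orthogonal group `O(n)`, with the topology inherited from the space of matrices. -/
abbrev O (n : ℕ) : Type := Matrix.orthogonalGroup (Fin n) ℝ

/-- The unit sphere `𝕊ⁿ⁻¹` of `ℝⁿ`. -/
abbrev S (n : ℕ) : Type := sphere (0 : E n) 1

/-- The standard representation of `O(n)` on `ℝⁿ`: a matrix acts by `v ↦ A v`. -/
def stdRep (n : ℕ) : Representation ℝ (O n) (E n) where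
  toFun A := Matrix.toEuclideanLin (A : Matrix (Fin n) (Fin n) ℝ)
  map_one' := by ext v i; simp
  map_mul' A B := by ext v i; simp

theorem stdRep_apply {n : ℕ} (A : O n) (v : E n) :
    stdRep n A v = WithLp.toLp 2 ((A : Matrix (Fin n) (Fin n) ℝ).mulVec v.ofLp) := rfl

theorem norm_stdRep {n : ℕ} (A : O n) (v : E n) : ‖stdRep n A v‖ = ‖v‖ := by
  have hA : (A : Matrix (Fin n) (Fin n) ℝ).transpose * A = 1 :=
    (Matrix.mem_orthogonalGroup_iff' (Fin n) ℝ).1 A.2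
  have h : inner ℝ (stdRep n A v) (stdRep n A v) = inner ℝ v v := by
    simp only [stdRep_apply, EuclideanSpace.inner_eq_star_dotProduct, star_trivial]
    rw [Matrix.dotProduct_mulVec, Matrix.vecMul_mulVec, hA, Matrix.vecMul_one]
  rw [real_inner_self_eq_norm_sq, real_inner_self_eq_norm_sq] at h
  exact (pow_left_inj₀ (norm_nonneg _) (norm_nonneg _) two_ne_zero).1 h

/-- The action of `O(n)` on the unit sphere (subgroups of `O(n)` act by restriction). -/
instance sphereAction (n : ℕ) : MulAction (O n) (S n) where
  smul A x := ⟨stdRep n A x, by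
    rw [mem_sphere_zero_iff_norm, norm_stdRep]; exact mem_sphere_zero_iff_norm.1 x.2⟩
  one_smul x := Subtype.ext (by
    change stdRep n 1 (x : E n) = x
    rw [map_one]; rfl)
  mul_smul A B x := Subtype.ext (by
    change stdRep n (A * B) (x : E n) = stdRep n A (stdRep n B (x : E n))
    rw [map_mul]; rfl)

/-- The orbit space `𝕊ⁿ⁻¹/G`. -/
abbrev OrbitSpace {n : ℕ} (G : Subgroup (O n)) : Type := MulAction.orbitRel.Quotient G (S n)

/-- The quotient metric on `𝕊ⁿ⁻¹/G`: the distance between two orbits, measured in the standard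
(angular) metric of the unit sphere. -/
def orbitDist {n : ℕ} (G : Subgroup (O n)) (p q : OrbitSpace G) : ℝ :=
  ⨅ z : p.orbit × q.orbit, angle ((z.1 : S n) : E n) ((z.2 : S n) : E n)

/-- The diameter of `𝕊ⁿ⁻¹/G`. All distances lie in `[0, π]`, so that this is a supremum of a
bounded family. -/
def diamQuotient {n : ℕ} (G : Subgroup (O n)) : ℝ :=
  ⨆ z : OrbitSpace G × OrbitSpace G, orbitDist G z.1 z.2

section Representations

universe u v

variable {Γ : Type u} [Group Γ] {V : Type v} [AddCommGroup V] [Module ℝ V]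

/-- The `ℝ`-algebra of all equivariant endomorphisms of a real representation. -/
abbrev equivariantEnd (σ : Representation ℝ Γ V) : Subalgebra ℝ (Module.End ℝ V) :=
  Subalgebra.centralizer ℝ (Set.range σ)

/-- The representation `σ` on `V` is of type `F`, i.e. its algebra of equivariant endomorphisms
is isomorphic to `F`, and `V` is one-dimensional as a vector space over `F`, where `F` acts
through this isomorphism. -/
def IsOneDimOfType (F : Type) [Ring F] [Algebra ℝ F] (σ : Representation ℝ Γ V) : Prop :=
  ∃ e : F ≃ₐ[ℝ] equivariantEnd σ,
    @Module.finrank F V _ _ (Module.compHom V (e : F →+* equivariantEnd σ)) = 1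

/-- A real representation `V` is super-reducible if `V ≅ Wᵏ` with `W` irreducible and
`dim_F W = 1`, where `F = ℝ`, `ℂ` or `ℍ` is the type of `W`. -/
def IsSuperReducible (ρ : Representation ℝ Γ V) : Prop :=
  ∃ (W : Type v) (_ : AddCommGroup W) (_ : Module ℝ W) (σ : Representation ℝ Γ W) (k : ℕ),
    σ.IsIrreducible ∧
    Nonempty (ρ.Equiv (Representation.directSum fun _ : Fin k => σ)) ∧
    (IsOneDimOfType ℝ σ ∨ IsOneDimOfType ℂ σ ∨ IsOneDimOfType (Quaternion ℝ) σ)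

end Representations

/-- The restriction to `N` of the standard representation on `ℝⁿ`, for `N ≤ G ≤ O(n)`. -/
def restrictRep {n : ℕ} {G : Subgroup (O n)} (N : Subgroup G) : Representation ℝ N (E n) :=
  (stdRep n).comp (G.subtype.comp N.subtype)

end SphereQuotient

end

/-! Suppose `N` is neither irreducible nor super-reducible. It is enough to find a unit vector `y`
at angle at least `π/4` from every nonzero vector of every irreducible `N`-subrepresentation
(`exists_unit_forall_inner_le`). Since `N` is normal, `G` permutes these subrepresentations, so the
orbit of a unit vector in one of them stays at distance at least `π/4` from the orbit of `y`.

Take `y = (w₁ + w₂)/√2` with unit vectors `wᵢ` in orthogonal irreducibles `Wᵢ` and `w₂ ⟂ End_N(ℝⁿ)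
w₁`. For `U` irreducible with projection `P_U`, the vectors `P_U w₁` and `P_U w₂` are orthogonal,
because `P_U` is itself equivariant. By Schur, `|P_U wᵢ| ≤ |P_{Wᵢ} x|` for unit `x ∈ U`
(`norm_proj_sq_le`), and Bessel's inequality gives `|P_U (w₁ + w₂)| ≤ 1` (`inner_add_le_norm`).

If no such pair exists, equivariant endomorphisms move each nonzero vector of an irreducible onto
every vector of each irreducible orthogonal to it. Then `ℝⁿ` is a power of one irreducible `W`, and
`End_N(W)` moves some nonzero vector to all of `W`. This endomorphism algebra is `ℝ`, `ℂ` or `ℍ` by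
Frobenius, and `W` is one-dimensional over it (`isSuperReducible_of_forall_exists`). -/

/-! ### Frobenius' theorem on real division algebras -/

open Polynomial in
/-- In a finite-dimensional real algebra without zero divisors every element is, up to a real
translation, a square root of a real number. -/
theorem exists_sub_algebraMap_sq_eq {A : Type*} [Ring A] [Algebra ℝ A] [IsDomain A]
    [FiniteDimensional ℝ A] (x : A) :
    ∃ a b : ℝ, (x - algebraMap ℝ A a) ^ 2 = algebraMap ℝ A b := by
  have hx : IsIntegral ℝ x := IsIntegral.of_finite ℝ x
  have hd := (minpoly.irreducible hx).natDegree_le_two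
  have h0 : aeval x (minpoly ℝ x) = 0 := minpoly.aeval ℝ x
  rw [aeval_eq_sum_range' (n := 3) (by omega)] at h0
  have hm := minpoly.monic hx
  have hpos := minpoly.natDegree_pos hx
  set p := minpoly ℝ x
  simp only [Finset.sum_range_succ, Finset.sum_range_zero, zero_add, pow_zero, pow_one] at h0
  rcases (by omega : p.natDegree = 1 ∨ p.natDegree = 2) with h | h
  · have h1 : p.coeff 1 = 1 := by rw [← h]; exact hm
    have h2 : p.coeff 2 = 0 := coeff_eq_zero_of_natDegree_lt (by omega)
    refine ⟨-p.coeff 0, 0, ?_⟩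
    rw [h1, h2, one_smul, zero_smul, add_zero, Algebra.smul_def, mul_one, add_comm] at h0
    simp [h0]
  · have h2 : p.coeff 2 = 1 := by rw [← h]; exact hm
    -- Completing the square in the quadratic minimal polynomial.
    refine ⟨-(p.coeff 1 / 2), (p.coeff 1 / 2) ^ 2 - p.coeff 0, ?_⟩
    rw [h2, one_smul, Algebra.smul_def, Algebra.smul_def, mul_one] at h0
    have h3 : x ^ 2 = -(algebraMap ℝ A (p.coeff 0) + algebraMap ℝ A (p.coeff 1) * x) :=
      eq_neg_of_add_eq_zero_right h0
    have h4 : algebraMap ℝ A (p.coeff 1) = algebraMap ℝ A (p.coeff 1 / 2) +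
        algebraMap ℝ A (p.coeff 1 / 2) := by rw [← map_add]; congr 1; ring
    have h5 := Algebra.commutes (p.coeff 1 / 2) x
    rw [h4, add_mul] at h3
    rw [map_sub, map_neg, map_pow, sub_neg_eq_add, sq, add_mul, mul_add, mul_add, ← sq, ← sq, h3,
      ← h5]
    abel

/-- The dichotomy behind Frobenius' theorem: an element is real or, after an affine change
of variable, an imaginary unit. -/
theorem exists_eq_algebraMap_or_sq_eq_neg_one {A : Type*} [Ring A] [Algebra ℝ A] [IsDomain A]
    [FiniteDimensional ℝ A] (x : A) :
    (∃ a : ℝ, x = algebraMap ℝ A a) ∨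
      ∃ (a c : ℝ) (u : A), u * u = -1 ∧ x = algebraMap ℝ A a + c • u ∧
        u = c⁻¹ • (x - algebraMap ℝ A a) := by
  obtain ⟨a, b, h⟩ := exists_sub_algebraMap_sq_eq x
  rcases le_or_gt 0 b with hb | hb
  · left
    rw [← Real.sq_sqrt hb, map_pow] at h
    have hc : Commute (x - algebraMap ℝ A a) (algebraMap ℝ A √b) :=
      (Algebra.commutes _ _).symm
    rcases hc.sq_eq_sq_iff_eq_or_eq_neg.1 h with h | h
    · exact ⟨√b + a, by rw [map_add, ← h]; abel⟩
    · exact ⟨-√b + a, by rw [map_add, map_neg, ← h]; abel⟩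
  · right
    have hc : √(-b) ≠ 0 := (Real.sqrt_pos.2 (by linarith)).ne'
    refine ⟨a, √(-b), (√(-b))⁻¹ • (x - algebraMap ℝ A a), ?_, ?_, rfl⟩
    · rw [smul_mul_smul_comm, ← sq, ← sq, h, inv_pow, Real.sq_sqrt (by linarith),
        Algebra.algebraMap_eq_smul_one, smul_smul, inv_neg, neg_mul, inv_mul_cancel₀ hb.ne, neg_smul,
        one_smul]
    · rw [smul_inv_smul₀ hc]; abel

/-- The elements commuting with an imaginary unit `i` form the copy `ℝ + ℝ i` of `ℂ`. -/
theorem exists_eq_algebraMap_add_smul_of_commute {A : Type*} [Ring A] [Algebra ℝ A] [IsDomain A]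
    [FiniteDimensional ℝ A] {i x : A} (hi : i * i = -1) (hx : i * x = x * i) :
    ∃ a b : ℝ, x = algebraMap ℝ A a + b • i := by
  rcases exists_eq_algebraMap_or_sq_eq_neg_one x with ⟨a, rfl⟩ | ⟨a, c, u, hu, hxu, hux⟩
  · exact ⟨a, 0, by simp⟩
  · have hc : Commute u i := by
      rw [hux]
      refine Commute.smul_left ?_ _
      exact (Commute.sub_left hx.symm (Algebra.commutes _ _))
    have : u ^ 2 = i ^ 2 := by rw [sq, sq, hu, hi]
    rcases hc.sq_eq_sq_iff_eq_or_eq_neg.1 this with h | h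
    · exact ⟨a, c, by rw [hxu, h]⟩
    · exact ⟨a, -c, by rw [hxu, h, smul_neg, neg_smul]⟩

/-- **Frobenius' theorem**: a finite-dimensional real algebra without zero divisors is isomorphic
to `ℝ`, `ℂ` or `ℍ`. -/
theorem nonempty_algEquiv_real_or_complex_or_quaternion (A : Type*) [Ring A] [Algebra ℝ A]
    [IsDomain A] [FiniteDimensional ℝ A] :
    Nonempty (ℝ ≃ₐ[ℝ] A) ∨ Nonempty (ℂ ≃ₐ[ℝ] A) ∨ Nonempty (Quaternion ℝ ≃ₐ[ℝ] A) := by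
  by_cases hR : ∀ x : A, ∃ a : ℝ, x = algebraMap ℝ A a
  · left
    refine ⟨AlgEquiv.ofBijective (Algebra.ofId ℝ A) ⟨(algebraMap ℝ A).injective, fun x => ?_⟩⟩
    obtain ⟨a, rfl⟩ := hR x
    exact ⟨a, rfl⟩
  right
  push Not at hR
  obtain ⟨x, hx⟩ := hR
  obtain ⟨i, hi⟩ : ∃ i : A, i * i = -1 := by
    rcases exists_eq_algebraMap_or_sq_eq_neg_one x with ⟨a, h⟩ | ⟨_, _, u, hu, _⟩
    · exact absurd h (hx a)
    · exact ⟨u, hu⟩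
  have h2 : (2 : A) ≠ 0 := by
    have := (algebraMap ℝ A).injective.ne (two_ne_zero' ℝ)
    rwa [map_ofNat, map_zero] at this
  by_cases hC : ∀ x : A, i * x = x * i
  · left
    refine ⟨AlgEquiv.ofBijective (Complex.lift ⟨i, hi⟩) ⟨RingHom.injective _, fun x => ?_⟩⟩
    obtain ⟨a, b, rfl⟩ := exists_eq_algebraMap_add_smul_of_commute hi (hC x)
    exact ⟨⟨a, b⟩, by simp [Complex.liftAux_apply]⟩
  right
  push Not at hC
  obtain ⟨x, hx⟩ := hC
  have hii (z : A) : i * (i * z) = -z := by rw [← mul_assoc, hi, neg_one_mul]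
  -- Conjugation by `i` is the involution `z ↦ -i z i`; `z - i z i` and `z + i z i` are twice the
  -- components of `z` commuting and anticommuting with `i`.
  have hanti (z : A) : i * (z + i * z * i) = -((z + i * z * i) * i) := by
    simp only [mul_add, add_mul, mul_assoc, hii, hi, mul_neg, mul_one, neg_add]; abel
  obtain ⟨j, hj, hij⟩ : ∃ j : A, j * j = -1 ∧ i * j = -(j * i) := by
    set y := x + i * x * i with hy
    have hiy : i * y = -(y * i) := hanti x
    have hy0 : y ≠ 0 := by
      intro h0
      apply hx
      have : i * y = i * x - x * i := by
        rw [hy, mul_add, mul_assoc, hii]; abel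
      rw [h0, mul_zero] at this
      exact (sub_eq_zero.1 this.symm)
    have hyi : y * i = -(i * y) := by rw [hiy, neg_neg]
    rcases exists_eq_algebraMap_or_sq_eq_neg_one y with ⟨a, h⟩ | ⟨a, c, u, hu, hyu, huy⟩
    · exfalso
      have h1 : i * y = y * i := by rw [h]; exact (Algebra.commutes _ _).symm
      have h3 : 2 * (y * i) = 0 := by
        rw [two_mul]; nth_rewrite 1 [← h1]; rw [hiy]; abel
      have h4 : i ≠ 0 := by rintro rfl; simp at hi
      exact (mul_ne_zero h2 (mul_ne_zero hy0 h4)) h3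
    · -- `y²` commutes with `i`, so that the real part of `y` vanishes.
      refine ⟨u, hu, ?_⟩
      have hyy : i * (y * y) = y * y * i := by
        rw [← mul_assoc, hiy, neg_mul, mul_assoc, hiy, mul_neg, neg_neg, mul_assoc]
      have hyy' : y * y = algebraMap ℝ A (a ^ 2 - c ^ 2) + (2 * a) • (y - algebraMap ℝ A a) := by
        have h5 : y - algebraMap ℝ A a = c • u := by rw [hyu]; abel
        rw [h5, hyu]
        simp only [add_mul, mul_add, Algebra.algebraMap_eq_smul_one, smul_mul_smul_comm, hu,
          one_mul, mul_one]
        module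
      have ha : a = 0 := by
        by_contra ha
        have h6 : Commute i ((2 * a) • y) := by
          have : (2 * a) • y = y * y - algebraMap ℝ A (a ^ 2 - c ^ 2) +
              (2 * a) • algebraMap ℝ A a := by rw [hyy', smul_sub]; abel
          rw [this]
          refine ((Commute.sub_right hyy ?_).add_right (Commute.smul_right ?_ _))
          · exact (Algebra.commutes _ _).symm
          · exact (Algebra.commutes _ _).symm
        have h7 : Commute i y := (Commute.smul_right_iff₀ (by simpa using ha)).1 h6
        have h8 : 2 * (y * i) = 0 := by
          rw [two_mul]; nth_rewrite 1 [← h7.eq]; rw [hiy]; abel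
        have h4 : i ≠ 0 := by rintro rfl; simp at hi
        exact (mul_ne_zero h2 (mul_ne_zero hy0 h4)) h8
      rw [huy, ha, map_zero, sub_zero, mul_smul_comm, hiy, smul_mul_assoc, smul_neg]
  have hji : j * i = -(i * j) := by rw [hij, neg_neg]
  let q : QuaternionAlgebra.Basis A (-1 : ℝ) 0 (-1) :=
    { i := i, j := j, k := i * j
      i_mul_i := by simp [hi]
      j_mul_j := by simp [hj]
      i_mul_j := rfl
      j_mul_i := by simp [hji] }
  let f : Quaternion ℝ →ₐ[ℝ] A := q.liftHom
  refine ⟨AlgEquiv.ofBijective f ⟨RingHom.injective (f : Quaternion ℝ →+* A), fun z => ?_⟩⟩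
  obtain ⟨a, b, h1⟩ : ∃ a b : ℝ, z - i * z * i = algebraMap ℝ A a + b • i := by
    refine exists_eq_algebraMap_add_smul_of_commute hi ?_
    simp only [mul_sub, sub_mul, mul_assoc, hii, hi, mul_neg, mul_one]; abel
  -- A product of two elements anticommuting with `i` commutes with `i`.
  obtain ⟨c, d, h3⟩ : ∃ c d : ℝ, (z + i * z * i) * j = algebraMap ℝ A c + d • i := by
    refine exists_eq_algebraMap_add_smul_of_commute hi ?_
    rw [← mul_assoc, hanti, neg_mul, mul_assoc, hij, mul_neg, neg_neg]
    simp only [mul_assoc]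
  have h4 : z + i * z * i = -(c • j + d • (i * j)) := by
    have : (z + i * z * i) * j * j = -(z + i * z * i) := by rw [mul_assoc, hj, mul_neg_one]
    rw [h3] at this
    rw [← neg_eq_iff_eq_neg, ← this, add_mul, smul_mul_assoc, ← Algebra.smul_def]
  refine ⟨⟨a / 2, b / 2, -c / 2, -d / 2⟩, ?_⟩
  have h5 : z = (1 / 2 : ℝ) • ((z - i * z * i) + (z + i * z * i)) := by
    module
  rw [h5, h1, h4]
  change q.lift _ = _
  simp only [QuaternionAlgebra.Basis.lift, Algebra.algebraMap_eq_smul_one, q]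
  module

/-! ### Equivariant endomorphisms, with irreducible subrepresentations as atoms -/

namespace Representation

open SphereQuotient Module

section Algebraic

variable {Γ V : Type*} [Group Γ] [AddCommGroup V] [Module ℝ V] {ρ : Representation ℝ Γ V}

theorem mem_equivariantEnd {T : End ℝ V} :
    T ∈ equivariantEnd ρ ↔ ∀ g v, T (ρ g v) = ρ g (T v) := by
  simp only [Subalgebra.mem_centralizer_iff, Set.forall_mem_range, LinearMap.ext_iff,
    End.mul_apply, eq_comm]

/-- The kernel of an equivariant endomorphism. -/
def kerSubrep {T : End ℝ V} (hT : T ∈ equivariantEnd ρ) : Subrepresentation ρ where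
  toSubmodule := LinearMap.ker T
  apply_mem_toSubmodule g v hv := by
    rw [LinearMap.mem_ker] at hv ⊢
    rw [mem_equivariantEnd.1 hT, hv, map_zero]

theorem subrep_eq_bot_iff {U : Subrepresentation ρ} : U = ⊥ ↔ U.toSubmodule = ⊥ :=
  Subrepresentation.toSubmodule_injective.eq_iff (b := ⊥) |>.symm

theorem subrep_eq_top_iff {U : Subrepresentation ρ} : U = ⊤ ↔ U.toSubmodule = ⊤ :=
  Subrepresentation.toSubmodule_injective.eq_iff (b := ⊤) |>.symm

/-- A subrepresentation that meets an irreducible one contains it. -/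
theorem le_of_isAtom_of_mem {U K : Subrepresentation ρ} (hU : IsAtom U) {v : V}
    (hv : v ∈ U.toSubmodule) (hvK : v ∈ K.toSubmodule) (h0 : v ≠ 0) : U ≤ K := by
  rcases hU.le_iff.1 (inf_le_left : U ⊓ K ≤ U) with h | h
  · have : v ∈ (U ⊓ K).toSubmodule := ⟨hv, hvK⟩
    rw [subrep_eq_bot_iff.1 h] at this
    exact absurd ((Submodule.mem_bot ℝ).1 this) h0
  · exact inf_eq_left.1 h

theorem exists_ne_zero_of_isAtom {U : Subrepresentation ρ} (hU : IsAtom U) :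
    ∃ v ∈ U.toSubmodule, v ≠ 0 :=
  Submodule.exists_mem_ne_zero_of_ne_bot fun h => hU.1 (subrep_eq_bot_iff.2 h)

end Algebraic

/-! ### Orthogonal projections, Schur's lemma and the angle estimate -/

section Isometric

variable {Γ V : Type*} [Group Γ] [NormedAddCommGroup V] [InnerProductSpace ℝ V]
  {ρ : Representation ℝ Γ V}

theorem inner_map_map_of_norm_map (hρ : ∀ g v, ‖ρ g v‖ = ‖v‖) (g : Γ) (v w : V) :
    inner ℝ (ρ g v) (ρ g w) = inner ℝ v w :=
  (LinearIsometry.mk (ρ g) (hρ g)).inner_map_map v w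

theorem inner_map_left_of_norm_map (hρ : ∀ g v, ‖ρ g v‖ = ‖v‖) (g : Γ) (v w : V) :
    inner ℝ (ρ g v) w = inner ℝ v (ρ g⁻¹ w) := by
  rw [← inner_map_map_of_norm_map hρ g v, self_inv_apply]

/-- The orthogonal complement of a subrepresentation of an isometric representation. -/
noncomputable def orthogonalSubrep (hρ : ∀ g v, ‖ρ g v‖ = ‖v‖) (U : Subrepresentation ρ) :
    Subrepresentation ρ where
  toSubmodule := U.toSubmoduleᗮ
  apply_mem_toSubmodule g v hv := by
    rw [Submodule.mem_orthogonal'] at hv ⊢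
    intro u hu
    rw [inner_map_left_of_norm_map hρ]
    exact hv _ (U.apply_mem_toSubmodule _ hu)

variable [FiniteDimensional ℝ V]

instance : WellFoundedLT (Subrepresentation ρ) :=
  (show StrictMono (Subrepresentation.toSubmodule (ρ := ρ)) from
    fun _ _ h => h).wellFoundedLT

/-- The orthogonal projection onto a subrepresentation, as an endomorphism. -/
noncomputable def proj (U : Subrepresentation ρ) : End ℝ V :=
  (U.toSubmodule.starProjection : V →ₗ[ℝ] V)

theorem proj_mem (U : Subrepresentation ρ) (v : V) : proj U v ∈ U.toSubmodule :=
  U.toSubmodule.starProjection_apply_mem v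

theorem proj_eq_self {U : Subrepresentation ρ} {v : V} (hv : v ∈ U.toSubmodule) : proj U v = v :=
  Submodule.starProjection_eq_self_iff.2 hv

theorem inner_proj_left (U : Subrepresentation ρ) (v w : V) :
    inner ℝ (proj U v) w = inner ℝ v (proj U w) :=
  U.toSubmodule.inner_starProjection_left_eq_right v w

/-- Both `U` and its orthogonal complement are invariant. -/
theorem proj_mem_equivariantEnd (hρ : ∀ g v, ‖ρ g v‖ = ‖v‖) (U : Subrepresentation ρ) :
    proj U ∈ equivariantEnd ρ := by
  rw [mem_equivariantEnd]
  intro g v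
  refine Submodule.eq_starProjection_of_mem_of_inner_eq_zero
    (U.apply_mem_toSubmodule g (proj_mem U v)) fun w hw => ?_
  rw [← map_sub, inner_map_left_of_norm_map hρ]
  exact U.toSubmodule.starProjection_inner_eq_zero v _ (U.apply_mem_toSubmodule _ hw)

/-- Schur's lemma for symmetric equivariant endomorphisms. -/
theorem exists_eq_smul_of_isSymmetric {U : Subrepresentation ρ} (hU : IsAtom U) {S : End ℝ V}
    (hS : S ∈ equivariantEnd ρ) (hSym : S.IsSymmetric)
    (hSU : ∀ v ∈ U.toSubmodule, S v ∈ U.toSubmodule) :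
    ∃ c : ℝ, ∀ v ∈ U.toSubmodule, S v = c • v := by
  obtain ⟨v₀, hv₀, h0⟩ := exists_ne_zero_of_isAtom hU
  have : Nontrivial U.toSubmodule := ⟨⟨⟨v₀, hv₀⟩, 0, fun h => h0 (congrArg Subtype.val h)⟩⟩
  -- A symmetric operator on `U` has a real eigenvector; its eigenspace is an invariant kernel
  -- meeting `U`, hence containing it.
  have hev := (hSym.restrict_invariant hSU).hasEigenvalue_iSup_of_finiteDimensional
  obtain ⟨w, hw⟩ := hev.exists_hasEigenvector
  generalize (⨆ _, _ : ℝ) = c at hw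
  have hw1 : S w = c • (w : V) := congrArg Subtype.val hw.apply_eq_smul
  have hT : S - algebraMap ℝ _ c ∈ equivariantEnd ρ := sub_mem hS (Subalgebra.algebraMap_mem _ c)
  have hle : U ≤ kerSubrep hT := by
    refine le_of_isAtom_of_mem hU w.2 ?_ (fun h => hw.2 (Subtype.ext h))
    change (S - algebraMap ℝ _ c) w = 0
    simp [hw1, Module.algebraMap_end_apply]
  refine ⟨c, fun v hv => ?_⟩
  have : (S - algebraMap ℝ _ c) v = 0 := hle hv
  simpa [Module.algebraMap_end_apply, sub_eq_zero] using this

/-- The squared length of the projection of `w ∈ W` to `U`, for `U`, `W` irreducible, is at most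
the factor by which projecting `U` to `W` scales squared lengths. -/
theorem norm_proj_sq_le (hρ : ∀ g v, ‖ρ g v‖ = ‖v‖) {U W : Subrepresentation ρ}
    (hU : IsAtom U) (hW : IsAtom W) {w x : V} (hw : w ∈ W.toSubmodule) (hx : x ∈ U.toSubmodule) :
    ‖proj U w‖ ^ 2 * ‖x‖ ^ 2 ≤ ‖proj W x‖ ^ 2 * ‖w‖ ^ 2 := by
  have key {U W : Subrepresentation ρ} (hU : IsAtom U) :
      ∃ c : ℝ, ∀ v ∈ U.toSubmodule, proj U (proj W v) = c • v := by
    -- The extra factor `proj U` makes the operator symmetric on all of `V` and changes nothing on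
    -- `U`.
    have hmem : proj U * (proj W * proj U) ∈ equivariantEnd ρ :=
      mul_mem (proj_mem_equivariantEnd hρ U)
        (mul_mem (proj_mem_equivariantEnd hρ W) (proj_mem_equivariantEnd hρ U))
    obtain ⟨c, hc⟩ := exists_eq_smul_of_isSymmetric hU hmem
      (fun v w => by simp only [End.mul_apply, inner_proj_left]) (fun v _ => proj_mem U _)
    refine ⟨c, fun v hv => ?_⟩
    rw [← hc v hv, End.mul_apply, End.mul_apply, proj_eq_self hv]
  obtain ⟨s, hs⟩ := key (W := W) hU
  obtain ⟨t, ht⟩ := key (W := U) hW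
  have hsq {U W : Subrepresentation ρ} {c : ℝ}
      (hc : ∀ v ∈ U.toSubmodule, proj U (proj W v) = c • v) {v : V} (hv : v ∈ U.toSubmodule) :
      ‖proj W v‖ ^ 2 = c * ‖v‖ ^ 2 := by
    have h1 : proj W v = proj W (proj W v) := (proj_eq_self (proj_mem W v)).symm
    rw [← real_inner_self_eq_norm_sq, inner_proj_left, ← h1, ← proj_eq_self hv, inner_proj_left,
      proj_eq_self hv, hc v hv, inner_smul_right, real_inner_self_eq_norm_sq]
  have h1 := hsq hs hx
  have h2 := hsq ht hw
  -- Computing `‖proj W (proj U w)‖ ^ 2` with either scalar gives `t² = s t` for `w ≠ 0`; so `t` is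
  -- `0` or `s`, and `t ≤ s` as `s ≥ 0`.
  have h3 := hsq hs (proj_mem U w)
  rw [ht w hw, norm_smul, mul_pow, Real.norm_eq_abs, sq_abs, h2] at h3
  rw [h1, h2]
  rcases eq_or_ne w 0 with rfl | hw0
  · simp
  rcases eq_or_ne x 0 with rfl | hx0
  · simp
  have hwp : 0 < ‖w‖ ^ 2 := by positivity
  have hxp : 0 < ‖x‖ ^ 2 := by positivity
  have hs0 : 0 ≤ s := by
    by_contra! h
    nlinarith [sq_nonneg ‖proj W x‖]
  have hts : t ≤ s := by
    by_contra! h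
    have : t * t * ‖w‖ ^ 2 = s * t * ‖w‖ ^ 2 := by linarith
    have := mul_right_cancel₀ hwp.ne' this
    nlinarith
  nlinarith [mul_pos hwp hxp]

/-- If `w₁`, `w₂` are unit vectors in orthogonal irreducible subrepresentations and `w₂` is
orthogonal to all images of `w₁` under equivariant endomorphisms, then every vector in an
irreducible subrepresentation has an angle of at least `π / 4` with `w₁ + w₂`. -/
theorem inner_add_le_norm (hρ : ∀ g v, ‖ρ g v‖ = ‖v‖) {U W₁ W₂ : Subrepresentation ρ}
    (hU : IsAtom U) (hW₁ : IsAtom W₁) (hW₂ : IsAtom W₂)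
    (hW : W₁.toSubmodule ⟂ W₂.toSubmodule) {w₁ w₂ x : V}
    (hw₁ : w₁ ∈ W₁.toSubmodule) (hw₂ : w₂ ∈ W₂.toSubmodule) (h₁ : ‖w₁‖ = 1) (h₂ : ‖w₂‖ = 1)
    (h : ∀ T ∈ equivariantEnd ρ, inner ℝ (T w₁) w₂ = 0) (hx : x ∈ U.toSubmodule) :
    inner ℝ x (w₁ + w₂) ≤ ‖x‖ := by
  have e1 := norm_proj_sq_le hρ hU hW₁ hw₁ hx
  have e2 := norm_proj_sq_le hρ hU hW₂ hw₂ hx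
  have hcross : inner ℝ (proj U w₁) (proj U w₂) = 0 := by
    rw [← inner_proj_left, proj_eq_self (proj_mem U _)]
    exact h _ (proj_mem_equivariantEnd hρ U)
  have hsum : ‖proj U (w₁ + w₂)‖ ^ 2 = ‖proj U w₁‖ ^ 2 + ‖proj U w₂‖ ^ 2 := by
    rw [map_add, norm_add_sq_real, hcross]; ring
  have hbessel : ‖proj W₁ x‖ ^ 2 + ‖proj W₂ x‖ ^ 2 ≤ ‖x‖ ^ 2 := by
    have horth : inner ℝ (proj W₁ x) (proj W₂ x) = 0 :=
      Submodule.isOrtho_iff_inner_eq.1 hW _ (proj_mem _ _) _ (proj_mem _ _)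
    have hself (W : Subrepresentation ρ) : inner ℝ x (proj W x) = ‖proj W x‖ ^ 2 := by
      rw [← real_inner_self_eq_norm_sq, inner_proj_left, proj_eq_self (proj_mem W x)]
    have := sq_nonneg ‖x - (proj W₁ x + proj W₂ x)‖
    rw [norm_sub_sq_real, norm_add_sq_real, inner_add_right, hself, hself, horth] at this
    linarith
  rw [h₁] at e1
  rw [h₂] at e2
  have hle : ‖proj U (w₁ + w₂)‖ * ‖x‖ ≤ ‖x‖ := by
    refine le_of_sq_le_sq ?_ (norm_nonneg _)
    rw [mul_pow, hsum]
    linarith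
  calc inner ℝ x (w₁ + w₂) = inner ℝ x (proj U (w₁ + w₂)) := by
        rw [← inner_proj_left, proj_eq_self hx]
    _ ≤ ‖x‖ * ‖proj U (w₁ + w₂)‖ := real_inner_le_norm _ _
    _ ≤ ‖x‖ := by rwa [mul_comm]

end Isometric

/-! ### One-dimensionality over the type; transport of irreducibles -/

section Irreducible

variable {Γ V : Type*} [Group Γ] [AddCommGroup V] [Module ℝ V]

theorem isIrreducible_toRepresentation {ρ : Representation ℝ Γ V} {U : Subrepresentation ρ}
    (hU : IsAtom U) : U.toRepresentation.IsIrreducible := by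
  have hne : U.toSubmodule ≠ ⊥ := fun h => hU.1 (subrep_eq_bot_iff.2 h)
  obtain ⟨v, hv, hv0⟩ := Submodule.exists_mem_ne_zero_of_ne_bot hne
  refine { exists_pair_ne := ⟨⊥, ⊤, fun h => hv0 ?_⟩, eq_bot_or_eq_top := fun K => ?_ }
  · have : (⟨v, hv⟩ : U.toSubmodule) ∈ (⊥ : Subrepresentation U.toRepresentation).toSubmodule := by
      rw [h]; trivial
    exact congrArg Subtype.val ((Submodule.mem_bot ℝ).1 this)
  · let L : Subrepresentation ρ :=
      { toSubmodule := K.toSubmodule.map U.toSubmodule.subtype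
        apply_mem_toSubmodule := by
          rintro g _ ⟨u, hu, rfl⟩
          exact ⟨_, K.apply_mem_toSubmodule g hu, rfl⟩ }
    have hL : L ≤ U := by
      rintro _ ⟨u, -, rfl⟩
      exact u.2
    rcases hU.le_iff.1 hL with h | h
    · left
      rw [subrep_eq_bot_iff] at h ⊢
      exact Submodule.map_injective_of_injective U.toSubmodule.injective_subtype
        (h.trans (Submodule.map_bot _).symm)
    · right
      rw [subrep_eq_top_iff, eq_top_iff]
      intro u _
      have hu : (u : V) ∈ L.toSubmodule := by rw [h]; exact u.2
      obtain ⟨u', hu', h'⟩ := hu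
      rwa [← Subtype.ext h']

variable {ρ σ : Representation ℝ Γ V}

/-- Schur: the kernel of the left factor is invariant, so that factor is injective or zero. -/
theorem noZeroDivisors_equivariantEnd (hσ : σ.IsIrreducible) :
    NoZeroDivisors (equivariantEnd σ) where
  eq_zero_or_eq_zero_of_mul_eq_zero {S T} hST := by
    rcases hσ.eq_bot_or_eq_top (kerSubrep S.2) with h | h
    · right
      refine Subtype.ext (LinearMap.ext fun v => ?_)
      have : (T : End ℝ V) v ∈ (kerSubrep S.2).toSubmodule :=
        LinearMap.congr_fun (congrArg Subtype.val hST) v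
      rw [h] at this
      exact (Submodule.mem_bot ℝ).1 this
    · left
      refine Subtype.ext (LinearMap.ext fun v => ?_)
      have : v ∈ (kerSubrep S.2).toSubmodule := by rw [h]; trivial
      exact this

theorem isOneDimOfType_of_algEquiv {F : Type} [DivisionRing F] [Algebra ℝ F]
    (e : F ≃ₐ[ℝ] equivariantEnd σ) {w : V} (hw : w ≠ 0)
    (h : ∀ v, ∃ T ∈ equivariantEnd σ, T w = v) : IsOneDimOfType F σ := by
  refine ⟨e, ?_⟩
  let _ : Module F V := Module.compHom V (e : F →+* equivariantEnd σ)
  refine finrank_eq_one w hw fun v => ?_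
  obtain ⟨T, hT, hv⟩ := h v
  refine ⟨e.symm ⟨T, hT⟩, ?_⟩
  change ((e (e.symm ⟨T, hT⟩) : equivariantEnd σ) : End ℝ V) w = v
  rw [e.apply_symm_apply, hv]

/-- If one nonzero vector of an irreducible representation is moved to all other vectors by
equivariant endomorphisms, the representation is one-dimensional over its type. -/
theorem isOneDimOfType_of_forall_exists [FiniteDimensional ℝ V] (hσ : σ.IsIrreducible) {w : V}
    (hw : w ≠ 0) (h : ∀ v, ∃ T ∈ equivariantEnd σ, T w = v) :
    IsOneDimOfType ℝ σ ∨ IsOneDimOfType ℂ σ ∨ IsOneDimOfType (Quaternion ℝ) σ := by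
  have : Nontrivial V := ⟨⟨w, 0, hw⟩⟩
  have := noZeroDivisors_equivariantEnd hσ
  have : IsDomain (equivariantEnd σ) := NoZeroDivisors.to_isDomain _
  rcases nonempty_algEquiv_real_or_complex_or_quaternion (equivariantEnd σ) with ⟨⟨e⟩⟩ | ⟨⟨e⟩⟩ | ⟨⟨e⟩⟩
  · exact .inl (isOneDimOfType_of_algEquiv e hw h)
  · exact .inr (.inl (isOneDimOfType_of_algEquiv e hw h))
  · exact .inr (.inr (isOneDimOfType_of_algEquiv e hw h))

/-- A linear automorphism normalizing the image of `ρ` permutes the irreducible subrepresentations. -/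
theorem exists_isAtom_map_mem {A : V ≃ₗ[ℝ] V} (hA : ∀ g, ∃ g', ∀ v, ρ g (A v) = A (ρ g' v))
    (hA' : ∀ g, ∃ g', ∀ v, A (ρ g v) = ρ g' (A v)) {U : Subrepresentation ρ} (hU : IsAtom U) :
    ∃ U' : Subrepresentation ρ, IsAtom U' ∧ ∀ v ∈ U.toSubmodule, A v ∈ U'.toSubmodule := by
  let U' : Subrepresentation ρ :=
    { toSubmodule := U.toSubmodule.map (A : V →ₗ[ℝ] V)
      apply_mem_toSubmodule := by
        rintro g _ ⟨u, hu, rfl⟩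
        obtain ⟨g', hg'⟩ := hA g
        exact ⟨_, U.apply_mem_toSubmodule g' hu, (hg' u).symm⟩ }
  refine ⟨U', ⟨fun h => hU.1 ?_, fun K hK => ?_⟩, fun v hv => ⟨v, hv, rfl⟩⟩
  · rw [subrep_eq_bot_iff] at h ⊢
    exact Submodule.map_injective_of_injective A.injective (h.trans (Submodule.map_bot _).symm)
  -- A proper subrepresentation of the image pulls back along `A` to a proper one of `U`, which is
  -- zero.
  · let K' : Subrepresentation ρ :=
      { toSubmodule := K.toSubmodule.comap (A : V →ₗ[ℝ] V)
        apply_mem_toSubmodule := by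
          intro g v hv
          obtain ⟨g', hg'⟩ := hA' g
          change A (ρ g v) ∈ K.toSubmodule
          rw [hg']
          exact K.apply_mem_toSubmodule g' hv }
    have hK' : K' < U := by
      refine ⟨fun v hv => ?_, fun hle => hK.2 ?_⟩
      · obtain ⟨u, hu, h⟩ := hK.1 hv
        rwa [← A.injective h]
      · rintro _ ⟨u, hu, rfl⟩
        exact hle hu
    have := hU.2 K' hK'
    rw [subrep_eq_bot_iff] at this ⊢
    rw [Submodule.eq_bot_iff] at this ⊢
    intro v hv
    have h0 := this (A.symm v) (show A (A.symm v) ∈ K.toSubmodule by rwa [A.apply_symm_apply])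
    simpa using h0

/-- An equivariant bijection from a power of `σ` onto `ρ`, as an equivalence with a direct sum. -/
theorem nonempty_equiv_directSum_of_bijective {W : Type*} [AddCommGroup W] [Module ℝ W]
    {ρ : Representation ℝ Γ V} {σ : Representation ℝ Γ W} {k : ℕ} (Φ : (Fin k → W) →ₗ[ℝ] V)
    (hΦ : Function.Bijective Φ) (hΦρ : ∀ g f, Φ (fun i => σ g (f i)) = ρ g (Φ f)) :
    Nonempty (ρ.Equiv (Representation.directSum fun _ : Fin k => σ)) := by
  let e : (DirectSum (Fin k) fun _ => W) ≃ₗ[ℝ] V :=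
    (DirectSum.linearEquivFunOnFintype ℝ (Fin k) fun _ => W).trans (LinearEquiv.ofBijective Φ hΦ)
  refine ⟨(Equiv.mk e fun g => LinearMap.ext fun x => ?_).symm⟩
  exact hΦρ g (DirectSum.linearEquivFunOnFintype ℝ (Fin k) (fun _ => W) x)

end Irreducible

/-! ### Super-reducibility or a vector far from all irreducibles -/

section Isometric

variable {Γ V : Type*} [Group Γ] [NormedAddCommGroup V] [InnerProductSpace ℝ V]
  [FiniteDimensional ℝ V] {ρ : Representation ℝ Γ V}

theorem exists_isAtom_le {U : Subrepresentation ρ} (hU : U ≠ ⊥) : ∃ W : Subrepresentation ρ, W ≤ U ∧ IsAtom W := by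
  have := isAtomic_of_orderBot_wellFounded_lt (α := Subrepresentation ρ) wellFounded_lt
  obtain ⟨W, hW, hWU⟩ := (IsAtomic.eq_bot_or_exists_atom_le U).resolve_left hU
  exact ⟨W, hWU, hW⟩

theorem exists_isAtom_isOrtho (hρ : ∀ g v, ‖ρ g v‖ = ‖v‖) {U : Subrepresentation ρ}
    (hU : U ≠ ⊤) : ∃ W : Subrepresentation ρ, IsAtom W ∧ W.toSubmodule ⟂ U.toSubmodule := by
  have hne : orthogonalSubrep hρ U ≠ ⊥ := by
    rw [Ne, subrep_eq_bot_iff]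
    rw [Ne, subrep_eq_top_iff] at hU
    exact fun h => hU (Submodule.orthogonal_eq_bot_iff.1 h)
  obtain ⟨W, hWU, hW⟩ := exists_isAtom_le hne
  exact ⟨W, hW, hWU⟩

/-- If `w₁` is not moved to all of `W₂` by equivariant endomorphisms, there is a unit vector in
`W₂` orthogonal to all its images. -/
theorem exists_unit_forall_inner_eq_zero (hρ : ∀ g v, ‖ρ g v‖ = ‖v‖) {W₂ : Subrepresentation ρ}
    {w₁ v : V} (hv : v ∈ W₂.toSubmodule) (hne : ∀ T ∈ equivariantEnd ρ, T w₁ ≠ v) :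
    ∃ w₂ ∈ W₂.toSubmodule, ‖w₂‖ = 1 ∧ ∀ T ∈ equivariantEnd ρ, inner ℝ (T w₁) w₂ = 0 := by
  let M : Submodule ℝ V :=
    (Subalgebra.toSubmodule (equivariantEnd ρ)).map (LinearMap.applyₗ w₁) ⊓ W₂.toSubmodule
  have hM {u : V} (hu : u ∈ M) : ∃ T ∈ equivariantEnd ρ, T w₁ = u := hu.1
  let u := v - M.starProjection v
  have hu : u ∈ W₂.toSubmodule := sub_mem hv (M.starProjection_apply_mem v).2
  have hu0 : u ≠ 0 := by
    intro h
    obtain ⟨T, hT, h'⟩ := hM (M.starProjection_apply_mem v)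
    exact hne T hT (h'.trans (sub_eq_zero.1 h).symm)
  refine ⟨‖u‖⁻¹ • u, W₂.toSubmodule.smul_mem _ hu, norm_smul_inv_norm hu0, fun T hT => ?_⟩
  -- Against `u ∈ W₂` only the `W₂`-component of `T w₁` counts, and it is again an image of `w₁`; so
  -- `u ⟂ M` suffices.
  have hmem : proj W₂ (T w₁) ∈ M :=
    ⟨⟨proj W₂ * T, Subalgebra.mul_mem _ (proj_mem_equivariantEnd hρ W₂) hT, rfl⟩, proj_mem _ _⟩
  rw [inner_smul_right, ← proj_eq_self hu, ← inner_proj_left, real_inner_comm,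
    M.starProjection_inner_eq_zero v _ hmem, mul_zero]

/-- A vector `w` generating under `equivariantEnd ρ` a nonzero vector of an irreducible `U` yields
an equivariant endomorphism embedding the irreducible `W ∋ w` into `U`. -/
theorem exists_injOn_of_mem (hρ : ∀ g v, ‖ρ g v‖ = ‖v‖) {W U : Subrepresentation ρ}
    (hW : IsAtom W) {w : V} (hw : w ∈ W.toSubmodule)
    (h : ∃ T ∈ equivariantEnd ρ, T w ∈ U.toSubmodule ∧ T w ≠ 0) :
    ∃ T ∈ equivariantEnd ρ, (∀ v, T v ∈ U.toSubmodule) ∧ ∀ v ∈ W.toSubmodule, T v = 0 → v = 0 := by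
  obtain ⟨T, hT, hTU, hT0⟩ := h
  have hPT := mul_mem (proj_mem_equivariantEnd hρ U) hT
  refine ⟨proj U * T, hPT, fun v => proj_mem U _, fun v hv hv0 => ?_⟩
  by_contra hne
  have hle := le_of_isAtom_of_mem (K := kerSubrep hPT) hW hv hv0 hne
  have : proj U (T w) = 0 := hle hw
  exact hT0 (by rwa [proj_eq_self hTU] at this)

/-- If the irreducible `W` embeds into every irreducible subrepresentation of `ρ`, then `ρ` is a
power of `W`. -/
theorem exists_equiv_directSum (hρ : ∀ g v, ‖ρ g v‖ = ‖v‖) {W : Subrepresentation ρ}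
    (hW : IsAtom W)
    (h : ∀ U : Subrepresentation ρ, IsAtom U → ∃ T ∈ equivariantEnd ρ,
      (∀ v, T v ∈ U.toSubmodule) ∧ ∀ v ∈ W.toSubmodule, T v = 0 → v = 0) :
    ∃ k : ℕ, Nonempty (ρ.Equiv (Representation.directSum fun _ : Fin k => W.toRepresentation)) := by
  by_contra hcon
  -- As long as the copies of `W` do not fill `V`, another one fits into an irreducible orthogonal
  -- to them. Were this never to stop, the dimension of `V` would be exceeded.
  have hex (k : ℕ) : ∃ Φ : (Fin k → W.toSubmodule) →ₗ[ℝ] V, Function.Injective Φ ∧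
      ∀ g f, Φ (fun i => W.toRepresentation g (f i)) = ρ g (Φ f) := by
    induction k with
    | zero => exact ⟨0, Function.injective_of_subsingleton _, fun g f => by simp⟩
    | succ k ih =>
      obtain ⟨Φ, hinj, hΦ⟩ := ih
      let R : Subrepresentation ρ :=
        { toSubmodule := LinearMap.range Φ
          apply_mem_toSubmodule := by
            rintro g _ ⟨f, rfl⟩
            exact ⟨_, hΦ g f⟩ }
      have hR : R ≠ ⊤ := fun hR => hcon ⟨k, nonempty_equiv_directSum_of_bijective Φ
        ⟨hinj, LinearMap.range_eq_top.1 (subrep_eq_top_iff.1 hR)⟩ hΦ⟩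
      obtain ⟨U, hU, hUR⟩ := exists_isAtom_isOrtho hρ hR
      obtain ⟨T, hT, hTU, hT0⟩ := h U hU
      refine ⟨Φ ∘ₗ LinearMap.funLeft ℝ _ Fin.succ +
        T ∘ₗ W.toSubmodule.subtype ∘ₗ LinearMap.proj 0, ?_, fun g f => ?_⟩
      · rw [injective_iff_map_eq_zero]
        intro f hf
        change Φ (fun i => f i.succ) + T (f 0) = 0 at hf
        have hz : T (f 0) = 0 := by
          have h1 : T (f 0) = Φ (-fun i => f i.succ) := by
            rw [map_neg]; exact (neg_eq_of_add_eq_zero_right hf).symm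
          refine (inner_self_eq_zero (𝕜 := ℝ)).1 ?_
          exact Submodule.isOrtho_iff_inner_eq.1 hUR _ (hTU _) _ ⟨_, h1.symm⟩
        rw [hz, add_zero] at hf
        have h2 := (injective_iff_map_eq_zero Φ).1 hinj _ hf
        funext i
        refine Fin.cases ?_ (fun i => congrFun h2 i) i
        exact Subtype.ext (hT0 _ (f 0).2 hz)
      · change Φ (fun i => W.toRepresentation g (f i.succ)) + T (ρ g (f 0)) =
          ρ g (Φ (fun i => f i.succ) + T (f 0))
        rw [hΦ, mem_equivariantEnd.1 hT, map_add]
  obtain ⟨Φ, hinj, -⟩ := hex (finrank ℝ V + 1)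
  have hle := LinearMap.finrank_le_finrank_of_injective hinj
  rw [finrank_pi_fintype, Finset.sum_const, Finset.card_univ, Fintype.card_fin, smul_eq_mul] at hle
  have hpos : 0 < finrank ℝ W.toSubmodule := by
    rw [Nat.pos_iff_ne_zero, Ne, Submodule.finrank_eq_zero]
    exact fun h => hW.1 (subrep_eq_bot_iff.2 h)
  nlinarith

/-- A reducible isometric representation is super-reducible if every nonzero vector of an
irreducible subrepresentation is moved by equivariant endomorphisms to all vectors of every
irreducible subrepresentation orthogonal to it. -/
theorem isSuperReducible_of_forall_exists (hρ : ∀ g v, ‖ρ g v‖ = ‖v‖) {W : Subrepresentation ρ}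
    (hW : IsAtom W) (hW_top : W ≠ ⊤)
    (h : ∀ W₁ W₂ : Subrepresentation ρ, IsAtom W₁ → IsAtom W₂ →
      W₁.toSubmodule ⟂ W₂.toSubmodule → ∀ w ∈ W₁.toSubmodule, w ≠ 0 → ∀ v ∈ W₂.toSubmodule,
        ∃ T ∈ equivariantEnd ρ, T w = v) : IsSuperReducible ρ := by
  obtain ⟨w, hw, hw0⟩ := exists_ne_zero_of_isAtom hW
  have hself : ∀ v ∈ W.toSubmodule, ∃ T ∈ equivariantEnd ρ, T w = v := by
    intro v hv
    -- The hypothesis only concerns orthogonal pairs, so `w` reaches `v` by a detour through `U ⟂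
    -- W`.
    obtain ⟨U, hU, hUW⟩ := exists_isAtom_isOrtho hρ hW_top
    obtain ⟨u, hu, hu0⟩ := exists_ne_zero_of_isAtom hU
    obtain ⟨S, hS, rfl⟩ := h W U hW hU hUW.symm w hw hw0 u hu
    obtain ⟨T, hT, rfl⟩ := h U W hU hW hUW _ hu hu0 v hv
    exact ⟨T * S, mul_mem hT hS, rfl⟩
  have hirr := isIrreducible_toRepresentation hW
  obtain ⟨k, hk⟩ := exists_equiv_directSum hρ hW fun U hU => by
    refine exists_injOn_of_mem hρ hW hw ?_
    by_cases hWU : W.toSubmodule ⟂ U.toSubmodule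
    · obtain ⟨u, hu, hu0⟩ := exists_ne_zero_of_isAtom hU
      obtain ⟨T, hT, rfl⟩ := h W U hW hU hWU w hw hw0 u hu
      exact ⟨T, hT, hu, hu0⟩
    · rw [Submodule.isOrtho_iff_inner_eq] at hWU
      push Not at hWU
      obtain ⟨v, hv, u, hu, hne⟩ := hWU
      obtain ⟨T, hT, rfl⟩ := hself v hv
      -- `T w` is not orthogonal to `u ∈ U`, so its projection to `U` is nonzero.
      refine ⟨proj U * T, mul_mem (proj_mem_equivariantEnd hρ U) hT, proj_mem U _, fun h0 => ?_⟩
      rw [← proj_eq_self hu, ← inner_proj_left] at hne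
      exact hne (by rw [show proj U (T w) = 0 from h0, inner_zero_left])
  refine ⟨W.toSubmodule, inferInstance, inferInstance, W.toRepresentation, k, hirr, hk,
    isOneDimOfType_of_forall_exists hirr (w := ⟨w, hw⟩) (fun h => hw0 (congrArg Subtype.val h))
      fun v => ?_⟩
  obtain ⟨T, hT, hTv⟩ := hself v v.2
  have hPT := mul_mem (proj_mem_equivariantEnd hρ W) hT
  refine ⟨(proj W * T).restrict fun v _ => proj_mem W _, mem_equivariantEnd.2 fun g v => ?_, ?_⟩
  · exact Subtype.ext (mem_equivariantEnd.1 hPT g v)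
  · refine Subtype.ext ?_
    change proj W (T w) = v
    rw [hTv, proj_eq_self v.2]

/-- An isometric representation that is neither irreducible nor super-reducible admits a unit
vector whose angle with every vector in an irreducible subrepresentation is at least `π / 4`. -/
theorem exists_unit_forall_inner_le [Nontrivial V] (hρ : ∀ g v, ‖ρ g v‖ = ‖v‖)
    (h_irr : ¬ ρ.IsIrreducible) (h_sup : ¬ IsSuperReducible ρ) :
    ∃ y : V, ‖y‖ = 1 ∧ ∀ U : Subrepresentation ρ, IsAtom U → ∀ x ∈ U.toSubmodule,
      inner ℝ x y ≤ ‖x‖ * (√2 / 2) := by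
  have htop : (⊤ : Subrepresentation ρ) ≠ ⊥ := by
    rw [Ne, subrep_eq_bot_iff]; exact top_ne_bot
  obtain ⟨W, -, hW⟩ := exists_isAtom_le htop
  have hW_top : W ≠ ⊤ := by
    rintro rfl
    exact h_irr (isSimpleOrder_iff_isAtom_top.2 hW)
  have := mt (isSuperReducible_of_forall_exists hρ hW hW_top) h_sup
  push Not at this
  obtain ⟨W₁, W₂, hW₁, hW₂, horth, w, hw, hw0, v, hv, hne⟩ := this
  have hne' : ∀ T ∈ equivariantEnd ρ, T (‖w‖⁻¹ • w) ≠ v := fun T hT h =>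
    hne (‖w‖⁻¹ • T) (Subalgebra.smul_mem _ hT _) (by rw [← h, map_smul, LinearMap.smul_apply])
  obtain ⟨w₂, hw₂, h₂, h0⟩ := exists_unit_forall_inner_eq_zero hρ hv hne'
  have hw₁ : ‖w‖⁻¹ • w ∈ W₁.toSubmodule := W₁.toSubmodule.smul_mem _ hw
  have h₁ : ‖‖w‖⁻¹ • w‖ = 1 := norm_smul_inv_norm hw0
  generalize ‖w‖⁻¹ • w = w₁ at *
  have h12 : inner ℝ w₁ w₂ = 0 := Submodule.isOrtho_iff_inner_eq.1 horth _ hw₁ _ hw₂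
  refine ⟨(√2 / 2) • (w₁ + w₂), ?_, fun U hU x hx => ?_⟩
  · rw [← pow_left_inj₀ (norm_nonneg _) zero_le_one two_ne_zero, norm_smul, mul_pow,
      norm_add_sq_real, h12, h₁, h₂, Real.norm_eq_abs, sq_abs, div_pow, Real.sq_sqrt zero_le_two]
    norm_num
  · rw [inner_smul_right, mul_comm]
    gcongr
    exact inner_add_le_norm hρ hU hW₁ hW₂ horth hw₁ hw₂ h₁ h₂ h0 hx

end Isometric

end Representation

/-! ### Orbit distances and the conclusion -/

namespace SphereQuotient

open Representation InnerProductGeometry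

theorem pi_div_four_le_angle_of_inner_le {n : ℕ} {x y : E n} (hx : ‖x‖ = 1) (hy : ‖y‖ = 1)
    (h : inner ℝ x y ≤ √2 / 2) : Real.pi / 4 ≤ angle x y := by
  rw [angle, hx, hy, mul_one, div_one]
  have h4 : Real.arccos (√2 / 2) = Real.pi / 4 := by
    rw [← Real.cos_pi_div_four, Real.arccos_cos] <;> linarith [Real.pi_pos]
  rw [← h4]
  exact Real.antitone_arccos h

/-- The distance of two orbits is bounded below by a bound for the angles between them. -/
theorem le_diamQuotient {n : ℕ} {G : Subgroup (O n)} (x y : S n) {c : ℝ}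
    (h : ∀ a ∈ G, ∀ b ∈ G, c ≤ angle (stdRep n a x) (stdRep n b y)) : c ≤ diamQuotient G := by
  -- Without boundedness the real supremum would take its default value `0`.
  have hbdd : BddAbove (Set.range fun z : OrbitSpace G × OrbitSpace G => orbitDist G z.1 z.2) := by
    refine ⟨Real.pi, ?_⟩
    rintro _ ⟨⟨p, q⟩, rfl⟩
    obtain ⟨u, hu⟩ := MulAction.orbitRel.Quotient.nonempty_orbit p
    obtain ⟨v, hv⟩ := MulAction.orbitRel.Quotient.nonempty_orbit q
    refine (ciInf_le ⟨0, ?_⟩ (⟨u, hu⟩, ⟨v, hv⟩)).trans (angle_le_pi _ _)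
    rintro _ ⟨z, rfl⟩
    exact angle_nonneg _ _
  let p : OrbitSpace G := Quotient.mk'' x
  let q : OrbitSpace G := Quotient.mk'' y
  refine le_trans ?_ (le_ciSup hbdd (p, q))
  have : Nonempty (p.orbit × q.orbit) :=
    ⟨⟨x, MulAction.orbitRel.Quotient.mem_orbit.2 rfl⟩,
      ⟨y, MulAction.orbitRel.Quotient.mem_orbit.2 rfl⟩⟩
  refine le_ciInf fun z => ?_
  obtain ⟨⟨u, hu⟩, ⟨v, hv⟩⟩ := z
  obtain ⟨a, rfl⟩ : u ∈ MulAction.orbit G x := hu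
  obtain ⟨b, rfl⟩ : v ∈ MulAction.orbit G y := hv
  exact h a a.2 b b.2

/-- An element of `G` permutes the irreducible subrepresentations of a normal subgroup. -/
theorem exists_isAtom_stdRep_mem {n : ℕ} {G : Subgroup (O n)} {N : Subgroup G} (hN : N.Normal)
    {a : O n} (ha : a ∈ G) {U : Subrepresentation (restrictRep N)} (hU : IsAtom U) :
    ∃ U' : Subrepresentation (restrictRep N), IsAtom U' ∧
      ∀ v ∈ U.toSubmodule, stdRep n a v ∈ U'.toSubmodule := by
  let A : E n ≃ₗ[ℝ] E n := LinearEquiv.ofBijective (stdRep n a) ((stdRep n).apply_bijective a)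
  have hmul (b c : O n) (v : E n) : stdRep n b (stdRep n c v) = stdRep n (b * c) v := by
    rw [map_mul]; rfl
  refine exists_isAtom_map_mem (A := A) (fun g => ?_) (fun g => ?_) hU
  · refine ⟨⟨_, hN.conj_mem g g.2 (⟨a, ha⟩⁻¹ : G)⟩, fun v => ?_⟩
    change stdRep n g (stdRep n a v) = stdRep n a (stdRep n (a⁻¹ * g * a⁻¹⁻¹) v)
    rw [hmul, hmul]
    congr 2
    group
  · refine ⟨⟨_, hN.conj_mem g g.2 (⟨a, ha⟩ : G)⟩, fun v => ?_⟩
    change stdRep n a (stdRep n g v) = stdRep n (a * g * a⁻¹) (stdRep n a v)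
    rw [hmul, hmul]
    congr 2
    group

end SphereQuotient

open SphereQuotient Representation in
theorem lemma3 (n : ℕ) (hn : 1 ≤ n) (G : Subgroup (SphereQuotient.O n))
    (hG : IsClosed (G : Set (SphereQuotient.O n)))
    (hdiam : SphereQuotient.diamQuotient G < Real.pi / 4) (N : Subgroup G) (hN : N.Normal) :
    (SphereQuotient.restrictRep N).IsIrreducible ∨
      SphereQuotient.IsSuperReducible (SphereQuotient.restrictRep N) := by
  by_contra! hcon
  have : Nonempty (Fin n) := ⟨⟨0, hn⟩⟩
  have hρ (g : N) (v : E n) : ‖restrictRep N g v‖ = ‖v‖ := norm_stdRep _ v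
  obtain ⟨y, hy, hyU⟩ := exists_unit_forall_inner_le hρ hcon.1 hcon.2
  have hy0 : y ≠ 0 := by rintro rfl; simp at hy
  have htop : (⊤ : Subrepresentation (restrictRep N)) ≠ ⊥ := by
    rw [Ne, subrep_eq_bot_iff]; exact top_ne_bot
  obtain ⟨U, -, hU⟩ := exists_isAtom_le htop
  obtain ⟨u, hu, hu0⟩ := exists_ne_zero_of_isAtom hU
  have hx : ‖‖u‖⁻¹ • u‖ = 1 := norm_smul_inv_norm hu0
  have hxU : ‖u‖⁻¹ • u ∈ U.toSubmodule := U.toSubmodule.smul_mem _ hu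
  refine hdiam.not_ge (le_diamQuotient ⟨‖u‖⁻¹ • u, mem_sphere_zero_iff_norm.2 hx⟩
    ⟨y, mem_sphere_zero_iff_norm.2 hy⟩ fun a ha b hb => ?_)
  refine pi_div_four_le_angle_of_inner_le ((norm_stdRep _ _).trans hx)
    ((norm_stdRep _ _).trans hy) ?_
  -- The inner product of `a x` and `b y` is that of `b⁻¹ a x` and `y`, and `b⁻¹ a` carries `U` into
  -- an irreducible `U'`.
  obtain ⟨U', hU', hmem⟩ := exists_isAtom_stdRep_mem hN (mul_mem (inv_mem hb) ha) hU
  have h := hyU U' hU' _ (hmem _ hxU)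
  rw [norm_stdRep, hx, one_mul, map_mul, Module.End.mul_apply,
    inner_map_left_of_norm_map norm_stdRep, inv_inv] at h
  exact h
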